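/- Throughout, a hypergraph $\mathcal H=(\mathcal V(\mathcal H),\mathcal E(\mathcal H))$ consists of a finite vertex set and a set of non-empty subsets of it (the edges), no edge being properly contained in another. For a vertex $x$, the deletion $\mathcal H\setminus x$ has vertex set $\mathcal V(\mathcal H)\setminus\{x\}$ and edges $\{E\in\mathcal E(\mathcal H): x\notin E\}$; if $\{x\}\notin\mathcal E(\mathcal H)$, the contraction $\mathcal H/x$ has vertex set $\mathcal V(\mathcal H)\setminus\{x\}$ and edges $\{F\setminus\{x\}: x\in F\in\mathcal E(\mathcal H)\}\cup\{E\in\mathcal E(\mathcal H): x\notin E,\ F\setminus\{x\}\not\subseteq E \text{ for all } F\in\mathcal E(\mathcal H)\setminus\{E\}\}$. A set $W\subseteq\mathcal V(\mathcal H)$ is independent if it contains no edge. The hypergraph $\mathcal H$ is vertex decomposable, defined recursively, if either every vertex $x$ satisfies $\{x\}\in\mathcal E(\mathcal H)$ or lies in no edge, or there is a vertex $x$ with $\{x\}\notin\mathcal E(\mathcal H)$ such that $\mathcal H/x$ and $\mathcal H\setminus x$ are vertex decomposable and every independent set of $\mathcal H/x$ is properly contained in an independent set of $\mathcal H\setminus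 x$. Let $\Delta$ be a simplicial complex on a finite vertex set. A facet $F$ of $\Delta$ is a leaf if it is the only facet, or there is a facet $G\neq F$ with $F\cap H\subseteq F\cap G$ for every facet $H\ne F$. A subcollection of $\Delta$ is a simplicial complex all of whose facets are facets of $\Delta$. The complex $\Delta$ is a simplicial tree if any two facets are joined by a sequence of facets in which consecutive ones intersect, and every non-empty subcollection of $\Delta$ has a leaf. Let $\mathcal H(\Delta)$ be the hypergraph whose edges are the facets of $\Delta$. For a hypergraph $\mathcal H$ with edges $F_1,\dots,F_t$ and $\mathbf k_t=(k_1,\dots,k_t)\in\mathbb N_{>0}^t$, let $\mathcal H(\mathbf k_t)$ be the hypergraph with vertices $x_{j,f}$ for all $i$, all $x_j\in F_i$ and all $1\le f\le k_i$, whose edges are, for each $i$ with $F_i=\{x_{j_1},\dots,x_{j_b}\}$ ($b=|F_i|$), all sets $\{x_{j_1,f_1},\dots,x_{j_b,f_b}\}$ with $f_1,\dots,f_b\in\{1,\dots,k_i\}$ and $f_1+\cdots+f_b\le k_i+b-1$. **Theorem 3.4.** Let $\Delta$ be a simplicial tree with facets $F_1,\dots,F_t$, let $\mathbf k_t\in\mathbb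 N^t_{>0}$, and let $\mathcal H=\mathcal H(\Delta)$. Then the hypergraph $\mathcal H(\mathbf k_t)$ is vertex decomposable. -/

import Mathlib

namespace PreAbstractSimplicialComplex

variable {V : Type*}

/-- The facets (inclusion-maximal faces) of a simplicial complex. -/
def facets (Δ : PreAbstractSimplicialComplex V) : Set (Finset V) :=
  {F | Maximal (fun G => G ∈ Δ.faces) F}

/-- `Γ` is a subcollection of `Δ`: every facet of `Γ` is a facet of `Δ`. -/
def IsSubcollection (Γ Δ : PreAbstractSimplicialComplex V) : Prop :=
  Γ.facets ⊆ Δ.facets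

/-- `Δ` is connected: any two facets are joined by a chain of facets in which consecutive
members intersect. -/
def IsConnected (Δ : PreAbstractSimplicialComplex V) : Prop :=
  ∀ F ∈ Δ.facets, ∀ G ∈ Δ.facets,
    Relation.ReflTransGen
      (fun A B : Finset V =>
        A ∈ Δ.facets ∧ B ∈ Δ.facets ∧ ((A : Set V) ∩ (B : Set V)).Nonempty) F G

/-- The facet `F` is a leaf of `Δ`: it is the only facet, or there is another facet `G` (a branch)
such that `F ∩ H ⊆ F ∩ G` for every facet `H ≠ F`. -/
def IsLeaf (Δ : PreAbstractSimplicialComplex V) (F : Finset V) : Prop :=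
  F ∈ Δ.facets ∧
    (Δ.facets = {F} ∨
      ∃ G ∈ Δ.facets, G ≠ F ∧
        ∀ H ∈ Δ.facets, H ≠ F → (F : Set V) ∩ (H : Set V) ⊆ (F : Set V) ∩ (G : Set V))

/-- `Δ` is a simplicial tree: it is connected and every non-empty subcollection has a leaf. -/
def IsSimplicialTree (Δ : PreAbstractSimplicialComplex V) : Prop :=
  Δ.IsConnected ∧
    ∀ Γ : PreAbstractSimplicialComplex V,
      Γ.IsSubcollection Δ → Γ.facets.Nonempty → ∃ F, Γ.IsLeaf F

/-- The hypergraph on the vertices of `Δ` whose edges are the facets of `Δ`. -/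
def facetHypergraph (Δ : PreAbstractSimplicialComplex V) : Hypergraph V where
  vertexSet := {v | ({v} : Finset V) ∈ Δ.faces}
  edgeSet := (fun F : Finset V => (F : Set V)) '' Δ.facets
  subset_vertexSet_of_mem_edgeSet' := by
    rintro _ ⟨F, hF, rfl⟩ v hv
    exact (Δ.isRelLowerSet_faces hF.prop).2 (Finset.singleton_subset_iff.2 hv)
      (Finset.singleton_nonempty v)

end PreAbstractSimplicialComplex

namespace Hypergraph

variable {α : Type*}

/-- Every vertex of `H` is isolated, in the sense that it forms an edge by itself or lies in no
edge at all. -/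
def IsIsolatedHypergraph (H : Hypergraph α) : Prop :=
  ∀ x ∈ H.vertexSet, {x} ∈ H.edgeSet ∨ ∀ E ∈ H.edgeSet, x ∉ E

/-- `W` is an independent set of `H`: every edge has a vertex outside `W`. -/
def IsIndependent (H : Hypergraph α) (W : Set α) : Prop :=
  W ⊆ H.vertexSet ∧ ∀ E ∈ H.edgeSet, (E ∩ (H.vertexSet \ W)).Nonempty

/-- The deletion `H \ x`. -/
def deletion (H : Hypergraph α) (x : α) : Hypergraph α where
  vertexSet := H.vertexSet \ {x}
  edgeSet := {E | E ∈ H.edgeSet ∧ x ∉ E}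
  subset_vertexSet_of_mem_edgeSet' := by
    rintro E ⟨hE, hx⟩ v hv
    exact ⟨H.subset_vertexSet_of_mem_edgeSet' hE hv, fun h => hx (h ▸ hv)⟩

/-- The contraction `H / x` of a simple hypergraph: its edges are the inclusion-minimal sets among
the `E \ {x}`, that is, the sets `F \ {x}` for edges `F` through `x`, together with the edges `E`
that avoid `x` and contain no `F \ {x}` with `F ≠ E` an edge. -/
def contraction (H : Hypergraph α) (x : α) : Hypergraph α where
  vertexSet := H.vertexSet \ {x}
  edgeSet :=
    {E | ∃ F ∈ H.edgeSet, x ∈ F ∧ E = F \ {x}} ∪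
      {E | E ∈ H.edgeSet ∧ x ∉ E ∧ ∀ F ∈ H.edgeSet, F ≠ E → ¬ F \ {x} ⊆ E}
  subset_vertexSet_of_mem_edgeSet' := by
    rintro E (⟨F, hF, -, rfl⟩ | ⟨hE, hx, -⟩) v hv
    · exact ⟨H.subset_vertexSet_of_mem_edgeSet' hF hv.1, hv.2⟩
    · exact ⟨H.subset_vertexSet_of_mem_edgeSet' hE hv, fun h => hx (h ▸ hv)⟩

/-- Vertex decomposable (simple) hypergraphs. Edges of a hypergraph are non-empty by convention,
so `H / x` is only formed when `{x}` is not an edge, i.e. when `x` is a vertex of the independence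
complex of `H`. -/
inductive IsVertexDecomposable : Hypergraph α → Prop
  | isolated (H : Hypergraph α) (h : H.IsIsolatedHypergraph) : IsVertexDecomposable H
  | shedding (H : Hypergraph α) (x : α) (hx : x ∈ H.vertexSet) (hxE : {x} ∉ H.edgeSet)
      (hcontraction : IsVertexDecomposable (H.contraction x))
      (hdeletion : IsVertexDecomposable (H.deletion x))
      (hshedding : ∀ W, (H.contraction x).IsIndependent W →
        ∃ W', (H.deletion x).IsIndependent W' ∧ W ⊂ W') :
      IsVertexDecomposable H

/-- The hypergraph `H(k)` for a family `k` of natural numbers indexed by the (finite) edges of `H`.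
The pair `(v, f)` stands for the vertex `x_{v,f}`. An edge `F` contributes the vertices `x_{v,f}`
with `v ∈ F` and `1 ≤ f ≤ k_F` (only `f = 1` if `k_F = 0`), and the edges `{x_{v,f(v)} : v ∈ F}`
for all `f : F → {1, …, k_F}` whose values have sum at most `k_F + |F| - 1`. Only the values of `f`
on `F` matter. -/
noncomputable def expansion (H : Hypergraph α) (k : H.edgeSet → ℕ) : Hypergraph (α × ℕ) where
  vertexSet := {p | ∃ F : H.edgeSet, p.1 ∈ (F : Set α) ∧ 1 ≤ p.2 ∧ p.2 ≤ max 1 (k F)}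
  edgeSet :=
    {E | ∃ (F : H.edgeSet) (f : α → ℕ),
      (∀ v ∈ (F : Set α), 1 ≤ f v ∧ f v ≤ k F) ∧
      ∑ᶠ v ∈ (F : Set α), f v ≤ k F + (F : Set α).ncard - 1 ∧
      E = (fun v => (v, f v)) '' (F : Set α)}
  subset_vertexSet_of_mem_edgeSet' := by
    rintro _ ⟨F, f, hf, -, rfl⟩ _ ⟨v, hv, rfl⟩
    exact ⟨F, hv, (hf v hv).1, (hf v hv).2.trans (le_max_right _ _)⟩

end Hypergraph

/-!
In a forest of sets there are a member `F` and a vertex `y ∈ F` lying in every member that meets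
`F`. For `y` to exist, take a minimal subfamily that is attached to the rest of the forest at a
single point; such a point can be moved into the subfamily by the Helly property of forests, and
minimality then forces it into every member of the subfamily.

In the independence complex of the expansion the point `(y, 1)` is a shedding vertex. Indeed, an
independent set `W` not containing it but compatible with it misses some `(z, 1)` with `z ∈ F`, and
the last point of the first gap of `W` above `z` can be added to `W`: every facet through `z`
contains `y`, so lowering the index at `y` to `1` pays for raising the one at `z` past the gap.
Deleting `(y, 1)` raises the least index at `y`, and taking the link removes in addition `y` from
all facets, so both stay within one class of complexes attached to forests.
-/

section HasLeaves

variable {ι V : Type*} {F : ι → Set V}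

/-- Every finite subfamily of `F` has a leaf (subfamilies with at most one member trivially do).
This is the facet condition of a simplicial forest, for indexed families so that it passes to
traces `F i ∩ U` even when these coincide or become empty. -/
def HasLeaves (F : ι → Set V) : Prop :=
  ∀ s : Finset ι, s.Nontrivial → ∃ i ∈ s, ∃ j ∈ s, j ≠ i ∧ ∀ l ∈ s, l ≠ i → F i ∩ F l ⊆ F j

namespace HasLeaves

theorem inter (h : HasLeaves F) (U : Set V) : HasLeaves fun i => F i ∩ U := by
  intro s hs
  obtain ⟨i, hi, j, hj, hji, hleaf⟩ := h s hs
  exact ⟨i, hi, j, hj, hji, fun l hl hli v hv => ⟨hleaf l hl hli ⟨hv.1.1, hv.2.1⟩, hv.1.2⟩⟩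

theorem exists_separation (h : HasLeaves F) {a b : ι} (hab : a ≠ b) {s : Finset ι} (ha : a ∈ s)
    (hb : b ∈ s) (hs : ∀ i ∈ s, F a ∩ F b ⊆ F i → i = a ∨ i = b) :
    ∃ d : Set ι, a ∈ d ∧ b ∉ d ∧ ∀ i ∈ s, i ∈ d → ∀ j ∈ s, j ∉ d → F i ∩ F j ⊆ F a ∩ F b := by
  classical
  induction s using Finset.strongInduction with
  | H s ih =>
    obtain ⟨i, hi, j, hj, hji, hleaf⟩ := h s ⟨a, ha, b, hb, hab⟩
    by_cases hia : i = a
    · subst hia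
      obtain rfl : j = b := (hs j hj (hleaf b hb hab.symm)).resolve_left hji
      refine ⟨{i}, rfl, hab.symm, ?_⟩
      rintro _ - rfl l hl hli
      exact Set.subset_inter Set.inter_subset_left (hleaf l hl hli)
    by_cases hib : i = b
    · subst hib
      obtain rfl : j = a :=
        (hs j hj (Set.inter_comm _ _ ▸ hleaf a ha hab)).resolve_right hji
      refine ⟨{i}ᶜ, hab, fun h => h rfl, fun l hl hli _ _ hi' => ?_⟩
      obtain rfl := Set.notMem_compl_iff.1 hi'
      exact Set.inter_comm _ _ ▸ Set.subset_inter (hleaf l hl hli) Set.inter_subset_left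
    obtain ⟨d, had, hbd, hd⟩ := ih (s.erase i) (Finset.erase_ssubset hi)
      (Finset.mem_erase.2 ⟨Ne.symm hia, ha⟩) (Finset.mem_erase.2 ⟨Ne.symm hib, hb⟩)
      fun l hl => hs l (Finset.mem_of_mem_erase hl)
    -- The leaf `i` joins the side of its branch `j`.
    refine ⟨{l | if l = i then j ∈ d else l ∈ d}, by simpa [Ne.symm hia] using had,
      by simpa [Ne.symm hib] using hbd, fun l hl hld m hm hmd v hv => ?_⟩
    have hvj : l = i ∨ m = i → l ≠ m → v ∈ F j := by
      rintro (rfl | rfl) hlm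
      · exact hleaf m hm hlm.symm hv
      · exact hleaf l hl hlm hv.symm
    grind

theorem nonempty_inter_inter (h : HasLeaves F) {a b c : ι} (hab : (F a ∩ F b).Nonempty)
    (hac : (F a ∩ F c).Nonempty) (hbc : (F b ∩ F c).Nonempty) : (F a ∩ F b ∩ F c).Nonempty := by
  classical
  rcases eq_or_ne a b with rfl | hne
  · rwa [Set.inter_self]
  by_cases hsub : F a ∩ F b ⊆ F c
  · rwa [Set.inter_eq_left.2 hsub]
  -- Now `F a ∩ F b` separates `a` from `b`, so `F c` meets it whichever side `c` is on.
  obtain ⟨d, had, hbd, hd⟩ := h.exists_separation hne (s := {a, b, c}) (by simp) (by simp) (by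
    simp only [Finset.mem_insert, Finset.mem_singleton]
    rintro i (rfl | rfl | rfl) hi
    exacts [.inl rfl, .inr rfl, absurd hi hsub])
  by_cases hcd : c ∈ d
  · exact hbc.mono fun v hv => ⟨hd c (by simp) hcd b (by simp) hbd hv.symm, hv.2⟩
  · exact hac.mono fun v hv => ⟨hd a (by simp) had c (by simp) hcd hv, hv.2⟩

theorem exists_forall_mem_of_pairwise_inter (h : HasLeaves F) {s : Finset ι} (hs : s.Nonempty)
    (hinter : ∀ i ∈ s, ∀ j ∈ s, (F i ∩ F j).Nonempty) : ∃ y, ∀ i ∈ s, y ∈ F i := by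
  induction hs using Finset.Nonempty.cons_induction generalizing F with
  | singleton a => simpa [Set.Nonempty] using hinter a (by simp) a (by simp)
  | cons a s ha hs ih =>
    obtain ⟨y, hy⟩ := ih (h.inter (F a)) fun i hi j hj => by
      rw [← Set.inter_inter_distrib_right]
      exact h.nonempty_inter_inter (hinter i (by simp [hi]) j (by simp [hj]))
        (hinter i (by simp [hi]) a (by simp)) (hinter j (by simp [hj]) a (by simp))
    obtain ⟨i, hi⟩ := hs
    exact ⟨y, (Finset.forall_mem_cons ha _).2 ⟨(hy i hi).2, fun j hj => (hy j hj).1⟩⟩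

end HasLeaves

/-- The non-empty subfamily `c` of `s` hangs at the point `x`: a member of `s` outside `c` that
meets a member of `c` contains `x`. -/
def HangsAt (F : ι → Set V) (s c : Finset ι) (x : V) : Prop :=
  c ⊆ s ∧ c.Nonempty ∧ ∀ i ∈ c, ∀ j ∈ s, j ∉ c → (F i ∩ F j).Nonempty → x ∈ F j

theorem HangsAt.of_subset {s c e : Finset ι} {x : V} (hc : HangsAt F s c x) (hec : e ⊆ c)
    (he : e.Nonempty) (hx : ∀ i ∈ e, ∀ j ∈ c, j ∉ e → (F i ∩ F j).Nonempty → x ∈ F j) :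
    HangsAt F s e x :=
  ⟨hec.trans hc.1, he, fun i hi j hj hje hij => by
    by_cases hjc : j ∈ c
    · exact hx i hi j hjc hje hij
    · exact hc.2.2 i (hec hi) j hj hjc hij⟩

section Minimal

variable {s c : Finset ι} (hc : Minimal (fun c => ∃ x, HangsAt F s c x) c) {x : V}
  (hx : HangsAt F s c x)

include hc hx

theorem forall_mem_of_minimal_hangsAt {i : ι} (hi : i ∈ c) (hxi : x ∈ F i) :
    ∀ j ∈ c, x ∈ F j := by
  classical
  intro j hj
  by_contra hxj
  have hhang : HangsAt F s (c.filter (x ∉ F ·)) x :=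
    hx.of_subset (Finset.filter_subset _ _) ⟨j, Finset.mem_filter.2 ⟨hj, hxj⟩⟩
      fun _ _ l hl hle _ => by simpa [hl] using hle
  exact (Finset.mem_filter.1 (hc.le_of_le ⟨x, hhang⟩ (Finset.filter_subset _ _) hi)).2 hxi

theorem HasLeaves.nonempty_inter_inter_iUnion_of_minimal_hangsAt (h : HasLeaves F)
    (hxc : ∀ i ∈ c, x ∉ F i) {a b : ι} (ha : a ∈ s) (hac : a ∉ c) (hb : b ∈ s) (hbc : b ∉ c)
    (haU : (F a ∩ ⋃ i ∈ c, F i).Nonempty) (hbU : (F b ∩ ⋃ i ∈ c, F i).Nonempty) :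
    (F a ∩ F b ∩ ⋃ i ∈ c, F i).Nonempty := by
  classical
  rcases eq_or_ne a b with rfl | hab
  · rwa [Set.inter_self]
  by_contra hempty
  have hmiss : ∀ i ∈ c, ∀ v ∈ F i, v ∉ F a ∩ F b := fun i hi v hv hvab =>
    hempty ⟨v, hvab, Set.mem_biUnion hi hv⟩
  obtain ⟨v, hva, hvU⟩ := haU
  obtain ⟨w, hwb, hwU⟩ := hbU
  obtain ⟨p, hp, hvp⟩ := Set.mem_iUnion₂.1 hvU
  obtain ⟨q, hq, hwq⟩ := Set.mem_iUnion₂.1 hwU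
  have hxab : x ∈ F a ∩ F b :=
    ⟨hx.2.2 p hp a ha hac ⟨v, hvp, hva⟩, hx.2.2 q hq b hb hbc ⟨w, hwq, hwb⟩⟩
  obtain ⟨d, had, hbd, hd⟩ := h.exists_separation hab (s := insert a (insert b c)) (by simp)
    (by simp) (by
      intro i hi hsub
      have := fun hic => hxc i hic (hsub hxab)
      grind)
  have hpd : p ∈ d := by
    by_contra hpd
    exact hmiss p hp v hvp (hd a (by simp) had p (by simp [hp]) hpd ⟨hva, hvp⟩)
  have hhang : HangsAt F s (c.filter (· ∈ d)) x :=
    hx.of_subset (Finset.filter_subset _ _) ⟨p, Finset.mem_filter.2 ⟨hp, hpd⟩⟩ (by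
      rintro i hi j hj hjd ⟨u, hui, huj⟩
      obtain ⟨hi, hid⟩ := Finset.mem_filter.1 hi
      exact absurd (hd i (by simp [hi]) hid j (by simp [hj]) (by simpa [hj] using hjd) ⟨hui, huj⟩)
        (hmiss i hi u hui))
  have hqd : q ∈ d :=
    (Finset.mem_filter.1 (hc.le_of_le ⟨x, hhang⟩ (Finset.filter_subset _ _) hq)).2
  exact hmiss q hq w hwq (hd q (by simp [hq]) hqd b (by simp) hbd ⟨hwq, hwb⟩)

theorem HasLeaves.exists_hangsAt_mem_of_minimal_hangsAt (h : HasLeaves F)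
    (hne : ∀ i ∈ c, (F i).Nonempty) : ∃ y, HangsAt F s c y ∧ ∃ i ∈ c, y ∈ F i := by
  classical
  by_cases hxc : ∃ i ∈ c, x ∈ F i
  · exact ⟨x, hx, hxc⟩
  push Not at hxc
  set U : Set V := ⋃ i ∈ c, F i
  have hmeet : ∀ {i j}, i ∈ c → (F i ∩ F j).Nonempty → (F j ∩ U).Nonempty :=
    fun hi ⟨v, hvi, hvj⟩ => ⟨v, hvj, Set.mem_biUnion hi hvi⟩
  obtain ⟨y, hyU, hy⟩ : ∃ y ∈ U, ∀ j ∈ s, j ∉ c → (F j ∩ U).Nonempty → y ∈ F j := by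
    by_cases hN : (s.filter fun j => j ∉ c ∧ (F j ∩ U).Nonempty).Nonempty
    · obtain ⟨y, hy⟩ := (h.inter U).exists_forall_mem_of_pairwise_inter hN (by
        simp only [Finset.mem_filter]
        rintro i ⟨hi, hic, hiU⟩ j ⟨hj, hjc, hjU⟩
        rw [← Set.inter_inter_distrib_right]
        exact h.nonempty_inter_inter_iUnion_of_minimal_hangsAt hc hx hxc hi hic hj hjc hiU hjU)
      simp only [Finset.mem_filter] at hy
      obtain ⟨j, hj⟩ := hN
      exact ⟨y, (hy j (Finset.mem_filter.1 hj)).2, fun i hi hic hiU => (hy i ⟨hi, hic, hiU⟩).1⟩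
    · obtain ⟨i, hi⟩ := hx.2.1
      obtain ⟨y, hy⟩ := hne i hi
      exact ⟨y, Set.mem_biUnion hi hy, fun j hj hjc hjU =>
        absurd ⟨j, Finset.mem_filter.2 ⟨hj, hjc, hjU⟩⟩ hN⟩
  exact ⟨y, ⟨hx.1, hx.2.1, fun i hi j hj hjc hij => hy j hj hjc (hmeet hi hij)⟩,
    by simpa [U] using hyU⟩

end Minimal

theorem HasLeaves.exists_dominating {s : Finset ι} (h : HasLeaves F) (hs : s.Nonempty)
    (hne : ∀ i ∈ s, (F i).Nonempty) :
    ∃ i ∈ s, ∃ y ∈ F i, ∀ j ∈ s, (F i ∩ F j).Nonempty → y ∈ F j := by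
  obtain ⟨i₀, hi₀⟩ := hs
  obtain ⟨x₀, -⟩ := hne i₀ hi₀
  obtain ⟨c, hc⟩ := exists_minimal_of_wellFoundedLT (fun c => ∃ x, HangsAt F s c x)
    ⟨s, x₀, subset_rfl, ⟨i₀, hi₀⟩, fun _ _ j hj hjs => absurd hj hjs⟩
  obtain ⟨x, hx⟩ := hc.prop
  obtain ⟨y, hy, i, hi, hyi⟩ :=
    h.exists_hangsAt_mem_of_minimal_hangsAt hc hx fun i hi => hne i (hx.1 hi)
  refine ⟨i, hy.1 hi, y, hyi, fun j hj hij => ?_⟩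
  by_cases hjc : j ∈ c
  · exact forall_mem_of_minimal_hangsAt hc hy hi hyi j hjc
  · exact hy.2.2 i hi j hj hjc hij

end HasLeaves

/-- Vertex decomposability of a simplicial complex, given as its collection of faces (including
the empty one). It is the form in which vertex decomposability of a hypergraph is established: a
hypergraph inherits it from its independence complex. -/
inductive IsVertexDecomposableComplex {β : Type*} : Set (Set β) → Prop
  | simplex (S : Set β) : IsVertexDecomposableComplex (𝒫 S)
  | shedding (I : Set (Set β)) (x : β) (hx : {x} ∈ I)
      (hlink : IsVertexDecomposableComplex {W | x ∉ W ∧ insert x W ∈ I})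
      (hdeletion : IsVertexDecomposableComplex {W | x ∉ W ∧ W ∈ I})
      (hshedding : ∀ W, x ∉ W → insert x W ∈ I → ∃ W' ∈ I, x ∉ W' ∧ W ⊂ W') :
      IsVertexDecomposableComplex I

section WeightComplex

variable {ι V : Type*} {F : ι → Finset V} {t : ι → ℕ} {lo hi : V → ℕ} {W : Set (V × ℕ)} {y : V}

/-- The complex on the points `(v, j)` with `lo v ≤ j < hi v` whose faces are the sets `W` such
that, for every `i`, a choice of one point of `W` above each `v ∈ F i` has total weight at least
`t i`. For `lo = 1` and `t i = k i + |F i|` this is the independence complex of the expansion of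
the hypergraph with edges `F i` by `k`; general bounds `lo` make the class closed under deletions
and links. -/
def weightComplex (F : ι → Finset V) (t : ι → ℕ) (lo hi : V → ℕ) : Set (Set (V × ℕ)) :=
  {W | (∀ p ∈ W, p.2 ∈ Set.Ico (lo p.1) (hi p.1)) ∧
    ∀ (i : ι) (f : V → ℕ), (∀ v ∈ F i, (v, f v) ∈ W) → t i ≤ ∑ v ∈ F i, f v}

theorem weightComplex_mono {W' : Set (V × ℕ)} (hW' : W' ∈ weightComplex F t lo hi) (h : W ⊆ W') :
    W ∈ weightComplex F t lo hi :=
  ⟨fun p hp => hW'.1 p (h hp), fun i f hf => hW'.2 i f fun v hv => h (hf v hv)⟩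

theorem weightComplex_eq_powerset (h : ∀ i, t i ≤ ∑ v ∈ F i, lo v) :
    weightComplex F t lo hi = 𝒫 {p | p.2 ∈ Set.Ico (lo p.1) (hi p.1)} :=
  Set.ext fun _ => ⟨fun hW => hW.1, fun hW => ⟨hW, fun i _ hf =>
    (h i).trans (Finset.sum_le_sum fun v hv => (hW (hf v hv)).1)⟩⟩

variable [DecidableEq V]

theorem forall_mem_Ico_update_succ_iff :
    (∀ p ∈ W, p.2 ∈ Set.Ico (Function.update lo y (lo y + 1) p.1) (hi p.1)) ↔
      (y, lo y) ∉ W ∧ ∀ p ∈ W, p.2 ∈ Set.Ico (lo p.1) (hi p.1) := by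
  constructor
  · refine fun h => ⟨fun hy => by simpa using h _ hy, fun p hp => ⟨?_, (h p hp).2⟩⟩
    exact (le_update_self_iff.2 (Nat.le_succ _) p.1).trans (h p hp).1
  · rintro ⟨hy, h⟩ ⟨v, j⟩ hp
    refine ⟨?_, (h _ hp).2⟩
    rcases eq_or_ne v y with rfl | hv
    · have hne : j ≠ lo v := by rintro rfl; exact hy hp
      simpa using (h _ hp).1.lt_of_ne hne.symm
    · simpa [hv] using (h _ hp).1

theorem mem_deletion_weightComplex_iff :
    (y, lo y) ∉ W ∧ W ∈ weightComplex F t lo hi ↔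
      W ∈ weightComplex F t (Function.update lo y (lo y + 1)) hi := by
  simp only [weightComplex, Set.mem_ofPred_eq, forall_mem_Ico_update_succ_iff, and_assoc]

theorem mem_link_weightComplex_iff (hy : lo y < hi y) :
    (y, lo y) ∉ W ∧ insert (y, lo y) W ∈ weightComplex F t lo hi ↔
      W ∈ weightComplex (fun i => (F i).erase y) (fun i => if y ∈ F i then t i - lo y else t i)
        (Function.update lo y (lo y + 1)) hi := by
  simp only [weightComplex, Set.mem_ofPred_eq, forall_mem_Ico_update_succ_iff, and_assoc]
  refine and_congr_right fun _ => ?_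
  simp only [Set.forall_mem_insert, Set.mem_Ico, le_rfl, hy, true_and]
  refine and_congr_right fun hbd => forall_congr' fun i => ?_
  by_cases hyF : y ∈ F i
  · simp only [hyF, if_true]
    constructor
    · intro h f hf
      have := h (Function.update f y (lo y)) fun v hv => by
        rcases eq_or_ne v y with rfl | hvy
        · simp
        · exact .inr (by simpa [hvy] using hf v (Finset.mem_erase.2 ⟨hvy, hv⟩))
      rw [← Finset.add_sum_erase _ _ hyF, Function.update_self,
        Finset.sum_update_of_notMem (Finset.notMem_erase y _)] at this
      lia
    · intro h f hf
      have := h f fun v hv => (hf v (Finset.mem_of_mem_erase hv)).resolve_left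
        fun hvy => Finset.ne_of_mem_erase hv (congrArg Prod.fst hvy)
      have hlo : lo y ≤ f y := by
        rcases hf y hyF with hfy | hfy
        · exact (congrArg Prod.snd hfy).ge
        · exact (hbd _ hfy).1
      rw [← Finset.add_sum_erase _ _ hyF]
      lia
  · simp only [hyF, if_false, Finset.erase_eq_of_notMem, not_false_eq_true]
    refine forall_congr' fun f => imp_congr_left (forall₂_congr fun v hv => ?_)
    have : v ≠ y := fun h => hyF (h ▸ hv)
    simp [this]

/-- The upper bounds of a weight complex are saturated: a point `(v, hi v)` could not complete a
choice of weight less than `t i`. -/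
def IsSaturated (F : ι → Finset V) (t : ι → ℕ) (lo hi : V → ℕ) : Prop :=
  ∀ i, ∀ v ∈ F i, t i ≤ hi v + ∑ w ∈ (F i).erase v, lo w

namespace IsSaturated

theorem update_succ (h : IsSaturated F t lo hi) (y : V) :
    IsSaturated F t (Function.update lo y (lo y + 1)) hi := fun i v hv =>
  (h i v hv).trans (by gcongr; exact le_update_self_iff.2 (Nat.le_succ _) _)

theorem erase (h : IsSaturated F t lo hi) (y : V) :
    IsSaturated (fun i => (F i).erase y) (fun i => if y ∈ F i then t i - lo y else t i) lo hi := by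
  intro i v hv
  obtain ⟨hvy, hv⟩ := Finset.mem_erase.1 hv
  have := h i v hv
  by_cases hy : y ∈ F i
  · rw [← Finset.add_sum_erase _ _ (Finset.mem_erase.2 ⟨hvy.symm, hy⟩),
      Finset.erase_right_comm] at this
    simp only [hy, if_true]
    lia
  · simpa [hy, Finset.erase_eq_of_notMem] using this

theorem lt (h : IsSaturated F t lo hi) {i : ι} (hlt : ∑ v ∈ F i, lo v < t i) (hy : y ∈ F i) :
    lo y < hi y := by
  have := h i y hy
  rw [← Finset.add_sum_erase _ _ hy] at hlt
  lia

end IsSaturated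

theorem exists_mem_Ico_not_and_succ {P : ℕ → Prop} {a b : ℕ} (hab : a < b) (ha : ¬P a) :
    ∃ j ∈ Set.Ico a b, ¬P j ∧ (j + 1 = b ∨ P (j + 1)) := by
  by_contra! hmax
  have hall : ∀ j ≥ a, j < b ∧ ¬P j := Nat.le_induction ⟨hab, ha⟩ fun j hj ⟨hjb, hPj⟩ =>
    ⟨(Nat.succ_le_of_lt hjb).lt_of_ne (hmax j ⟨hj, hjb⟩ hPj).1, (hmax j ⟨hj, hjb⟩ hPj).2⟩
  exact (hall b hab.le).1.false

theorem IsSaturated.le_add_sum_erase_update (hsat : IsSaturated F t lo hi)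
    (hW : insert (y, lo y) W ∈ weightComplex F t lo hi) {i : ι} {z : V} (hz : z ∈ F i)
    {f : V → ℕ} (hf : ∀ v ∈ F i, v ≠ z → (v, f v) ∈ W) {j : ℕ} (hj : j = hi z ∨ (z, j) ∈ W) :
    t i ≤ j + ∑ v ∈ (F i).erase z, Function.update f y (lo y) v := by
  rcases hj with rfl | hj
  · refine (hsat i z hz).trans (by
      gcongr with v hv
      obtain ⟨hvz, hv⟩ := Finset.mem_erase.1 hv
      rcases eq_or_ne v y with rfl | hvy
      · simp
      · simpa [hvy] using (hW.1 _ (.inr (hf v hv hvz))).1)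
  · have := hW.2 i (Function.update (Function.update f y (lo y)) z j) fun v hv => by
      rcases eq_or_ne v z with rfl | hvz
      · exact .inr (by simpa)
      rcases eq_or_ne v y with rfl | hvy
      · exact .inl (by simp [hvz])
      · exact .inr (by simpa [hvy, hvz] using hf v hv hvz)
    rwa [← Finset.add_sum_erase _ _ hz, Function.update_self,
      Finset.sum_update_of_notMem (Finset.notMem_erase z _)] at this

theorem exists_insert_mem_weightComplex (hsat : IsSaturated F t lo hi) (hyW : (y, lo y) ∉ W)
    (hW : insert (y, lo y) W ∈ weightComplex F t lo hi) {z : V} (hzy : z ≠ y)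
    (hzW : (z, lo z) ∉ W) (hz : lo z < hi z)
    (hdom : ∀ i, ∑ v ∈ F i, lo v < t i → z ∈ F i → y ∈ F i) :
    ∃ j, (z, j) ∉ W ∧ insert (z, j) W ∈ weightComplex F t lo hi := by
  have hWmem := weightComplex_mono hW (Set.subset_insert _ _)
  have hbd := forall_mem_Ico_update_succ_iff.2 ⟨hyW, hWmem.1⟩
  obtain ⟨j, hj, hjW, hsucc⟩ := exists_mem_Ico_not_and_succ (P := fun j => (z, j) ∈ W) hz hzW
  refine ⟨j, hjW, Set.forall_mem_insert.2 ⟨hj, hWmem.1⟩, fun i f hf => ?_⟩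
  have hfW : ∀ v ∈ F i, v ≠ z → (v, f v) ∈ W := fun v hv hvz =>
    (hf v hv).resolve_left fun h => hvz (congrArg Prod.fst h)
  by_cases hzi : z ∈ F i ∧ (z, f z) ∉ W
  swap
  · exact hWmem.2 i f fun v hv => by grind
  obtain ⟨hzF, hfzW⟩ := hzi
  have hfz : f z = j := congrArg Prod.snd ((hf z hzF).resolve_right hfzW)
  rcases le_or_gt (t i) (∑ v ∈ F i, lo v) with hact | hact
  · refine hact.trans (Finset.sum_le_sum fun v hv => ?_)
    rcases eq_or_ne v z with rfl | hvz
    · exact hfz ▸ hj.1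
    · exact (hWmem.1 _ (hfW v hv hvz)).1
  -- Lowering the choice at `y` to `lo y` pays for raising it at `z` from `j` to `j + 1`.
  have hyF := hdom i hact hzF
  have hlt : lo y < f y := by simpa using (hbd _ (hfW y hyF hzy.symm)).1
  have hsum : ∑ v ∈ (F i).erase z, Function.update f y (lo y) v < ∑ v ∈ (F i).erase z, f v :=
    Finset.sum_lt_sum (fun v _ => update_le_self_iff.2 hlt.le v)
      ⟨y, Finset.mem_erase.2 ⟨hzy.symm, hyF⟩, by simpa⟩
  have := hsat.le_add_sum_erase_update hW hzF hfW hsucc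
  rw [← Finset.add_sum_erase _ _ hzF, hfz]
  lia

theorem weightComplex_shedding (hsat : IsSaturated F t lo hi) {i : ι}
    (hact : ∑ v ∈ F i, lo v < t i)
    (hdom : ∀ j, ∑ v ∈ F j, lo v < t j → (F i ∩ F j).Nonempty → y ∈ F j) (hyW : (y, lo y) ∉ W)
    (hW : insert (y, lo y) W ∈ weightComplex F t lo hi) :
    ∃ W' ∈ weightComplex F t lo hi, (y, lo y) ∉ W' ∧ W ⊂ W' := by
  obtain ⟨z, hzF, hz⟩ : ∃ z ∈ F i, (z, lo z) ∉ insert (y, lo y) W := by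
    by_contra! hall
    exact hact.not_ge (hW.2 i lo hall)
  obtain ⟨hzy, hzW⟩ := not_or.1 hz
  have hzy : z ≠ y := fun h => hzy (h ▸ rfl)
  obtain ⟨j, hjW, hW'⟩ := exists_insert_mem_weightComplex hsat hyW hW hzy hzW (hsat.lt hact hzF)
    fun k hk hzk => hdom k hk ⟨z, Finset.mem_inter.2 ⟨hzF, hzk⟩⟩
  refine ⟨_, hW', ?_, Set.ssubset_insert hjW⟩
  rintro (h | h)
  exacts [hzy (congrArg Prod.fst h).symm, hyW h]

theorem weightComplex_eq_deletion_of_notMem (hy : {(y, lo y)} ∉ weightComplex F t lo hi) :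
    weightComplex F t lo hi = weightComplex F t (Function.update lo y (lo y + 1)) hi :=
  Set.ext fun _ => by
    rw [← mem_deletion_weightComplex_iff, and_iff_right_of_imp]
    exact fun hW hyW => hy (weightComplex_mono hW (Set.singleton_subset_iff.2 hyW))

theorem sum_sub_update_succ_lt [Fintype ι] {i : ι} (hy : y ∈ F i) (hlt : lo y < hi y) :
    ∑ i, ∑ v ∈ F i, (hi v - Function.update lo y (lo y + 1) v) <
      ∑ i, ∑ v ∈ F i, (hi v - lo v) := by
  have hle : lo ≤ Function.update lo y (lo y + 1) := le_update_self_iff.2 (Nat.le_succ _)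
  refine Finset.sum_lt_sum (fun i _ => ?_) ⟨i, Finset.mem_univ i, ?_⟩
  · gcongr; exact hle _
  · refine Finset.sum_lt_sum (fun v _ => ?_) ⟨y, hy, by simpa using Nat.sub_succ_lt_self _ _ hlt⟩
    gcongr; exact hle _

theorem IsSaturated.isVertexDecomposableComplex [Finite ι] (hsat : IsSaturated F t lo hi)
    (hleaf : HasLeaves fun i => (F i : Set V)) (hempty : ∅ ∈ weightComplex F t lo hi) :
    IsVertexDecomposableComplex (weightComplex F t lo hi) := by
  cases nonempty_fintype ι
  induction hn : ∑ i, ∑ v ∈ F i, (hi v - lo v) using Nat.strong_induction_on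
    generalizing F t lo with
  | _ n ih =>
  by_cases hall : ∀ i, t i ≤ ∑ v ∈ F i, lo v
  · exact weightComplex_eq_powerset hall ▸ .simplex _
  push Not at hall
  obtain ⟨i, hact, y, hyi, hdom⟩ := hleaf.exists_dominating
    (s := Finset.univ.filter fun i => ∑ v ∈ F i, lo v < t i) (by simpa [Finset.Nonempty])
    fun i hact => Finset.coe_nonempty.2 <| Finset.nonempty_iff_ne_empty.2 fun hFi =>
      ((hempty.2 i lo (by simp [hFi])).trans_lt (Finset.mem_filter.1 hact).2).false
  simp only [Finset.mem_filter, Finset.mem_univ, true_and, ← Finset.coe_inter,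
    Finset.coe_nonempty, Finset.mem_coe] at hact hyi hdom
  have hlt := hsat.lt hact hyi
  have hmeasure := hn ▸ sum_sub_update_succ_lt hyi hlt
  have hdel := ih _ hmeasure (hsat.update_succ y) hleaf
    (mem_deletion_weightComplex_iff.1 ⟨Set.notMem_empty _, hempty⟩) rfl
  by_cases hy : {(y, lo y)} ∈ weightComplex F t lo hi
  swap
  · rwa [weightComplex_eq_deletion_of_notMem hy]
  have hlink := ih _ (hmeasure.trans_le' <| by gcongr; exact Finset.erase_subset _ _)
    ((hsat.erase y).update_succ y) (by simpa [Set.sdiff_eq] using hleaf.inter {y}ᶜ)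
    ((mem_link_weightComplex_iff hlt).1 ⟨Set.notMem_empty _, by simpa using hy⟩) rfl
  refine .shedding _ _ hy ?_ ?_ fun W hyW hW => weightComplex_shedding hsat hact hdom hyW hW
  · simpa only [mem_link_weightComplex_iff hlt, Set.ofPred_mem_eq] using hlink
  · simpa only [mem_deletion_weightComplex_iff, Set.ofPred_mem_eq] using hdel

end WeightComplex

section IndependenceComplex

variable {α : Type*} {H : Hypergraph α} {x : α} {W : Set α}

theorem isIndependent_iff_forall_not_subset :
    H.IsIndependent W ↔ W ⊆ H.vertexSet ∧ ∀ E ∈ H.edgeSet, ¬E ⊆ W := by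
  refine and_congr_right fun _ => forall₂_congr fun E hE => ?_
  rw [Set.not_subset]
  exact exists_congr fun v => and_congr_right fun hv =>
    and_iff_right (H.mem_vertexSet_of_mem_edgeSet hE hv)

/-- The edges of `H` are non-empty and pairwise incomparable, the standing convention for
hypergraphs in the paper. -/
structure IsSimpleHypergraph (H : Hypergraph α) : Prop where
  empty_notMem : ∅ ∉ H.edgeSet
  isAntichain : IsAntichain (· ⊆ ·) H.edgeSet

theorem isIndependent_deletion_iff :
    (H.deletion x).IsIndependent W ↔ x ∉ W ∧ H.IsIndependent W := by
  simp only [isIndependent_iff_forall_not_subset]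
  constructor
  · rintro ⟨hW, hE⟩
    have hxW : x ∉ W := fun h => (hW h).2 rfl
    exact ⟨hxW, fun v hv => (hW hv).1, fun E hEH hEW => hE E ⟨hEH, fun h => hxW (hEW h)⟩ hEW⟩
  · rintro ⟨hxW, hW, hE⟩
    exact ⟨fun v hv => ⟨hW hv, fun h => hxW (h ▸ hv)⟩, fun E hEH => hE E hEH.1⟩

theorem isIndependent_contraction_iff (hH : IsAntichain (· ⊆ ·) H.edgeSet)
    (hx : x ∈ H.vertexSet) :
    (H.contraction x).IsIndependent W ↔ x ∉ W ∧ H.IsIndependent (insert x W) := by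
  simp only [isIndependent_iff_forall_not_subset]
  constructor
  · rintro ⟨hW, hE⟩
    have hthrough : ∀ E ∈ H.edgeSet, x ∈ E → ¬E \ {x} ⊆ W := fun E hEH hxE =>
      hE _ (.inl ⟨E, hEH, hxE, rfl⟩)
    refine ⟨fun h => (hW h).2 rfl, Set.insert_subset hx fun v hv => (hW hv).1, fun E hEH hEW => ?_⟩
    by_cases hxE : x ∈ E
    · exact hthrough E hEH hxE (Set.sdiff_singleton_subset_iff.2 hEW)
    · have hEW' : E ⊆ W := (Set.subset_insert_iff_of_notMem hxE).1 hEW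
      refine hE E (.inr ⟨hEH, hxE, fun F hF hFE hFE' => ?_⟩) hEW'
      by_cases hxF : x ∈ F
      · exact hthrough F hF hxF (hFE'.trans hEW')
      · exact hFE (hH.eq hF hEH (Set.sdiff_singleton_eq_self hxF ▸ hFE'))
  · rintro ⟨hxW, hW, hE⟩
    refine ⟨fun v hv => ⟨hW (.inr hv), fun h => hxW (h ▸ hv)⟩, ?_⟩
    rintro E (⟨F, hF, -, rfl⟩ | ⟨hEH, -⟩) hEW
    · exact hE F hF (Set.sdiff_singleton_subset_iff.1 hEW)
    · exact hE E hEH (hEW.trans (Set.subset_insert _ _))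

namespace IsSimpleHypergraph

theorem deletion (hH : IsSimpleHypergraph H) (x : α) : IsSimpleHypergraph (H.deletion x) :=
  ⟨fun h => hH.empty_notMem h.1, hH.isAntichain.subset fun _ hE => hE.1⟩

theorem contraction (hH : IsSimpleHypergraph H) (hx : {x} ∉ H.edgeSet) :
    IsSimpleHypergraph (H.contraction x) where
  empty_notMem := by
    rintro (⟨F, hF, hxF, h⟩ | h)
    · exact hx ((Set.sdiff_eq_empty.1 h.symm).antisymm (Set.singleton_subset_iff.2 hxF) ▸ hF)
    · exact hH.empty_notMem h.1
  isAntichain := by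
    rintro E (⟨F, hF, hxF, rfl⟩ | ⟨hE, hxE, -⟩) E' (⟨F', hF', hxF', rfl⟩ | ⟨hE', hxE', hmin⟩) hne h
    · refine hne (congrArg (· \ {x}) (hH.isAntichain.eq hF hF' ?_))
      simpa [hxF'] using Set.sdiff_singleton_subset_iff.1 h
    · exact hmin F hF (fun hFE => hxE' (hFE ▸ hxF)) h
    · exact hxE (hH.isAntichain.eq hE hF' (h.trans Set.sdiff_subset) ▸ hxF')
    · exact hne (hH.isAntichain.eq hE hE' h)

theorem isIsolatedHypergraph (hH : IsSimpleHypergraph H) {S : Set α}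
    (hS : ∀ W, H.IsIndependent W ↔ W ⊆ S) : H.IsIsolatedHypergraph := by
  refine fun x _ => or_iff_not_imp_right.2 fun hx => ?_
  push Not at hx
  obtain ⟨E, hE, hxE⟩ := hx
  simp only [isIndependent_iff_forall_not_subset] at hS
  obtain ⟨y, hyE, hyS⟩ := Set.not_subset.1 fun hES => ((hS E).2 hES).2 E hE subset_rfl
  have hy := (hS {y}).not.2 fun h => hyS (h rfl)
  push Not at hy
  obtain ⟨F, hF, hFy⟩ := hy (Set.singleton_subset_iff.2 (H.mem_vertexSet_of_mem_edgeSet hE hyE))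
  rcases Set.subset_singleton_iff_eq.1 hFy with rfl | rfl
  · exact absurd hF hH.empty_notMem
  · obtain rfl := hH.isAntichain.eq hF hE (Set.singleton_subset_iff.2 hyE)
    obtain rfl : x = y := hxE
    exact hF

theorem isVertexDecomposable (hH : IsSimpleHypergraph H)
    (hI : IsVertexDecomposableComplex {W | H.IsIndependent W}) : H.IsVertexDecomposable := by
  generalize hHI : {W | H.IsIndependent W} = I at hI
  induction hI generalizing H with
  | simplex S => exact .isolated H (hH.isIsolatedHypergraph (Set.ext_iff.1 hHI))
  | shedding I x hx _ _ hshed ihlink ihdel =>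
    subst hHI
    obtain ⟨hxV, hxE⟩ := isIndependent_iff_forall_not_subset.1 hx
    have hcontr {W} : (H.contraction x).IsIndependent W ↔ x ∉ W ∧ H.IsIndependent (insert x W) :=
      isIndependent_contraction_iff hH.isAntichain (hxV rfl)
    refine .shedding H x (hxV rfl) (hxE _ · subset_rfl)
      (ihlink (hH.contraction (hxE _ · subset_rfl)) (Set.ext fun _ => hcontr))
      (ihdel (hH.deletion x) (Set.ext fun _ => isIndependent_deletion_iff)) fun W hW => ?_
    obtain ⟨W', hW', hxW', hWW'⟩ := hshed W (hcontr.1 hW).1 (hcontr.1 hW).2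
    exact ⟨W', isIndependent_deletion_iff.2 ⟨hxW', hW'⟩, hWW'⟩

end IsSimpleHypergraph

end IndependenceComplex

section Expansion

variable {V : Type*} {H : Hypergraph V}

theorem IsSimpleHypergraph.expansion (hH : IsSimpleHypergraph H) (k : H.edgeSet → ℕ) :
    IsSimpleHypergraph (H.expansion k) where
  empty_notMem := by
    rintro ⟨E, f, -, -, h⟩
    exact hH.empty_notMem (Set.image_eq_empty.1 h.symm ▸ E.2)
  isAntichain := by
    rintro _ ⟨E, f, -, -, rfl⟩ _ ⟨E', g, -, -, rfl⟩ hne h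
    have hfg : ∀ v ∈ (E : Set V), v ∈ (E' : Set V) ∧ f v = g v := by
      intro v hv
      obtain ⟨w, hw, hwv⟩ := h (Set.mem_image_of_mem _ hv)
      obtain ⟨rfl, hfg⟩ := Prod.ext_iff.1 hwv
      exact ⟨hw, hfg.symm⟩
    refine hne ?_
    rw [← Subtype.ext (hH.isAntichain.eq E.2 E'.2 fun v hv => (hfg v hv).1)]
    exact Set.image_congr fun v hv => by rw [(hfg v hv).2]

theorem exists_mem_vertexSet_expansion_iff [Finite H.edgeSet] (k : H.edgeSet → ℕ) :
    ∃ hi : V → ℕ, ∀ p, p ∈ (H.expansion k).vertexSet ↔ p.2 ∈ Set.Ico 1 (hi p.1) := by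
  classical
  cases nonempty_fintype H.edgeSet
  refine ⟨fun v => (Finset.univ.filter fun E : H.edgeSet => v ∈ (E : Set V)).sup
    (fun E => max 1 (k E)) + 1, fun p => ?_⟩
  simp only [Hypergraph.expansion, Set.mem_ofPred_eq, Set.mem_Ico, Nat.lt_succ_iff]
  constructor
  · rintro ⟨E, hE, hp, hpE⟩
    exact ⟨hp, hpE.trans (Finset.le_sup (f := fun E => max 1 (k E)) (by simpa))⟩
  · rintro ⟨hp, hp'⟩
    obtain ⟨E, hE, hpE⟩ := (Finset.le_sup_iff (Nat.bot_eq_zero ▸ hp)).1 hp'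
    exact ⟨E, (Finset.mem_filter.1 hE).2, hp, hpE⟩

section

variable {k : H.edgeSet → ℕ} {F : H.edgeSet → Finset V} (hF : ∀ E, (F E : Set V) = E) {hi : V → ℕ}
  (hhi : ∀ p, p ∈ (H.expansion k).vertexSet ↔ p.2 ∈ Set.Ico 1 (hi p.1))

include hF hhi

theorem setOf_isIndependent_expansion (hne : ∀ E, (F E).Nonempty) :
    {W | (H.expansion k).IsIndependent W} = weightComplex F (fun E => k E + (F E).card) 1 hi := by
  classical
  have hmem {v} {E : H.edgeSet} : v ∈ (E : Set V) ↔ v ∈ F E := by rw [← hF, Finset.mem_coe]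
  have hsum (f : V → ℕ) (E : H.edgeSet) : ∑ᶠ v ∈ (E : Set V), f v ≤ k E + (E : Set V).ncard - 1 ↔
      ∑ v ∈ F E, f v < k E + (F E).card := by
    rw [← hF, finsum_mem_coe_finset, Set.ncard_coe_finset]
    have := (hne E).card_pos
    lia
  ext W
  rw [Set.mem_ofPred_eq, isIndependent_iff_forall_not_subset, Set.subset_def,
    forall₂_congr fun p _ => hhi p]
  refine and_congr_right fun hbd => ⟨fun h E f hf => ?_, ?_⟩
  · by_contra! hlt
    refine h _ ⟨E, f, fun v hv => ?_, (hsum f E).2 hlt, rfl⟩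
      (Set.image_subset_iff.2 fun v hv => hf v (hmem.1 hv))
    have hone : ∀ v ∈ F E, 1 ≤ f v := fun v hv => (hbd _ (hf v hv)).1
    have hv := hmem.1 hv
    have hrest := ((F E).erase v).card_nsmul_le_sum f 1 fun w hw =>
      hone w (Finset.mem_of_mem_erase hw)
    rw [← Finset.add_sum_erase _ _ hv] at hlt
    rw [Finset.card_erase_of_mem hv] at hrest
    exact ⟨hone v hv, by lia⟩
  · rintro h _ ⟨E, f, -, hfE, rfl⟩ hW
    exact ((hsum f E).1 hfE).not_ge (h E f fun v hv => hW (Set.mem_image_of_mem _ (hmem.2 hv)))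

theorem isSaturated_expansion [DecidableEq V] :
    IsSaturated F (fun E => k E + (F E).card) 1 hi := by
  intro E v hv
  have hvE : v ∈ (E : Set V) := hF E ▸ hv
  have hmax : max 1 (k E) < hi v :=
    ((hhi (v, max 1 (k E))).1 ⟨E, hvE, le_max_left _ _, le_rfl⟩).2
  have := Finset.card_erase_add_one hv
  simp only [Pi.one_apply, Finset.sum_const, smul_eq_mul, mul_one]
  lia

end

theorem IsSimpleHypergraph.isVertexDecomposable_expansion [Finite H.edgeSet]
    (hH : IsSimpleHypergraph H) (hfin : ∀ E ∈ H.edgeSet, E.Finite)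
    (hleaf : HasLeaves (Subtype.val : H.edgeSet → Set V)) (k : H.edgeSet → ℕ) :
    (H.expansion k).IsVertexDecomposable := by
  classical
  obtain ⟨hi, hhi⟩ := exists_mem_vertexSet_expansion_iff k
  have hF (E : H.edgeSet) : ((hfin E E.2).toFinset : Set V) = E := Set.Finite.coe_toFinset _
  have hne (E : H.edgeSet) : (hfin E E.2).toFinset.Nonempty := by
    rw [← Finset.coe_nonempty, hF, Set.nonempty_iff_ne_empty]
    exact fun hE => hH.empty_notMem (hE ▸ E.2)
  refine (hH.expansion k).isVertexDecomposable ?_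
  rw [setOf_isIndependent_expansion hF hhi hne]
  refine (isSaturated_expansion hF hhi).isVertexDecomposableComplex (by simpa only [hF]) ?_
  exact ⟨fun _ => False.elim, fun E f h => absurd ((hne E).imp h) (by simp)⟩

end Expansion

section FacetHypergraph

variable {V : Type*} {Δ : PreAbstractSimplicialComplex V}

theorem isSimpleHypergraph_facetHypergraph (Δ : PreAbstractSimplicialComplex V) :
    IsSimpleHypergraph Δ.facetHypergraph where
  empty_notMem := by
    rintro ⟨A, hA, hempty⟩
    exact (Δ.isRelLowerSet_faces hA.prop).1.ne_empty (Finset.coe_eq_empty.1 hempty)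
  isAntichain := by
    rintro _ ⟨A, hA, rfl⟩ _ ⟨B, hB, rfl⟩ hne hAB
    exact hne (congrArg _ (hA.eq_of_le hB.prop (Finset.coe_subset.1 hAB)))

/-- The simplicial complex generated by `𝓢`, whose faces are the non-empty subsets of members
of `𝓢`. -/
def generatedComplex (𝓢 : Set (Finset V)) : PreAbstractSimplicialComplex V where
  faces := {A | A.Nonempty ∧ ∃ B ∈ 𝓢, A ⊆ B}
  isRelLowerSet_faces := fun _ hA =>
    ⟨hA.1, fun _ hBA hB => ⟨hB, hA.2.imp fun _ hC => ⟨hC.1, hBA.trans hC.2⟩⟩⟩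

theorem facets_generatedComplex {𝓢 : Set (Finset V)} (h𝓢 : 𝓢 ⊆ Δ.facets) :
    (generatedComplex 𝓢).facets = 𝓢 := by
  ext A
  constructor
  · intro hA
    obtain ⟨B, hB, hAB⟩ := hA.prop.2
    rwa [hA.eq_of_le ⟨(Δ.isRelLowerSet_faces (h𝓢 hB).prop).1, B, hB, subset_rfl⟩ hAB]
  · intro hA
    refine ⟨⟨(Δ.isRelLowerSet_faces (h𝓢 hA).prop).1, A, hA, subset_rfl⟩, ?_⟩
    rintro B ⟨-, C, hC, hBC⟩ hAB
    rwa [(h𝓢 hA).eq_of_le (h𝓢 hC).prop (hAB.trans hBC)]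

variable
  (hΔ : ∀ Γ : PreAbstractSimplicialComplex V,
    Γ.IsSubcollection Δ → Γ.facets.Nonempty → ∃ A, Γ.IsLeaf A)

include hΔ

theorem exists_leaf_of_subset_facets {𝓢 : Set (Finset V)} (h𝓢 : 𝓢 ⊆ Δ.facets)
    (hnt : 𝓢.Nontrivial) :
    ∃ A ∈ 𝓢, ∃ B ∈ 𝓢, B ≠ A ∧ ∀ C ∈ 𝓢, C ≠ A → (A ∩ C : Set V) ⊆ B := by
  have hfacets := facets_generatedComplex h𝓢
  obtain ⟨A, hA, hleaf⟩ := hΔ (generatedComplex 𝓢) (hfacets.subset.trans h𝓢)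
    (by rw [hfacets]; exact hnt.nonempty)
  rw [hfacets] at hA hleaf
  obtain ⟨B, hB, hBA, hleaf⟩ := hleaf.resolve_left hnt.ne_singleton
  exact ⟨A, hA, B, hB, hBA, fun C hC hCA => (hleaf C hC hCA).trans Set.inter_subset_right⟩

theorem hasLeaves_facetHypergraph :
    HasLeaves (Subtype.val : Δ.facetHypergraph.edgeSet → Set V) := by
  rintro s ⟨D, hD, D', hD', hne⟩
  choose A hA hAE using fun E : Δ.facetHypergraph.edgeSet => E.2
  have hinj : A.Injective := fun E E' h => Subtype.ext (by rw [← hAE E, ← hAE E', h])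
  obtain ⟨_, ⟨E, hE, rfl⟩, _, ⟨G, hG, rfl⟩, hGE, hleaf⟩ :=
    exists_leaf_of_subset_facets hΔ (𝓢 := A '' s) (Set.image_subset_iff.2 fun E _ => hA E)
      ⟨A D, ⟨D, hD, rfl⟩, A D', ⟨D', hD', rfl⟩, hinj.ne hne⟩
  refine ⟨E, hE, G, hG, fun h => hGE (h ▸ rfl), fun L hL hLE => ?_⟩
  simpa only [hAE] using hleaf (A L) ⟨L, hL, rfl⟩ (hinj.ne hLE)

end FacetHypergraph

theorem theorem3p4_general {V : Type*} (Δ : PreAbstractSimplicialComplex V)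
    (hfin : Δ.facets.Finite)
    (hΔ : ∀ Γ : PreAbstractSimplicialComplex V,
      Γ.IsSubcollection Δ → Γ.facets.Nonempty → ∃ A, Γ.IsLeaf A)
    (k : Δ.facetHypergraph.edgeSet → ℕ) :
    (Δ.facetHypergraph.expansion k).IsVertexDecomposable := by
  have : Finite Δ.facetHypergraph.edgeSet := hfin.image _
  refine (isSimpleHypergraph_facetHypergraph Δ).isVertexDecomposable_expansion ?_
    (hasLeaves_facetHypergraph hΔ) k
  rintro _ ⟨A, -, rfl⟩
  exact A.finite_toSet

theorem theorem3p4 {V : Type*} [Finite V] (Δ : PreAbstractSimplicialComplex V)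
    (hΔ : Δ.IsSimplicialTree) (k : Δ.facetHypergraph.edgeSet → ℕ) (hk : ∀ F, 0 < k F) :
    (Δ.facetHypergraph.expansion k).IsVertexDecomposable :=
  theorem3p4_general Δ (Set.toFinite _) hΔ.2 k
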